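/- Write permutations of $\{1,\dots,n\}$ in one-line notation $\pi=\pi_1\cdots\pi_n$. A Fishburn permutation is a permutation with no indices $j,k$ such that $j+1<k$, $\pi_j=\pi_k+1$ and $\pi_{j+1}>\pi_j$. An ascent of an integer sequence $a_1\cdots a_n$ is an index $j<n$ with $a_j<a_{j+1}$, and $\mathrm{asc}(a_1\cdots a_n)$ is the number of ascents. An ascent sequence of length $n$ is a sequence $a_1\cdots a_n$ of nonnegative integers with $a_1=0$ (if $n\ge 1$) and $a_j\le 1+\mathrm{asc}(a_1\cdots a_{j-1})$ for $2\le j\le n$. A sequence $\alpha$ contains a sequence $\beta$ if $\alpha$ has a (not necessarily consecutive) subsequence with the same length and relative order as $\beta$; otherwise $\alpha$ avoids $\beta$. For $n\ge 0$ let $F_n(3412)$ be the set of Fishburn permutations of length $n$ which avoid $3412$, and let $A_n(201)$ be the set of ascent sequences of length $n$ which avoid $201$. A site of a Fishburn permutation $\sigma$ of length $m$ is one of its $m+1$ gaps (before the first entry, between two consecutive entries, or after the last entry); it is active if inserting $m+1$ there gives a Fishburn permutation. The active sites of $\sigma$ are labelled $0,1,2,\dots$ from left to right. Every Fishburn permutation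 $\pi$ of length $n$ is built uniquely from the empty permutation by inserting $1,2,\dots,n$ successively into active sites; let $g(\pi)=a_1\cdots a_n$, where $a_i$ is the label of the active site into which $i$ is inserted. (This is the bijection of Bousquet-Mélou, Claesson, Dukes and Kitaev from Fishburn permutations of length $n$ to ascent sequences of length $n$.) **Proposition.** Let $\pi$ be a Fishburn permutation and let $\alpha=g(\pi)$. Then $\pi$ avoids $3412$ if and only if $\alpha$ avoids $201$. Moreover, for every $n\ge 0$, the map $g$ restricts to a bijection from $F_n(3412)$ to $A_n(201)$, and in particular $|F_n(3412)|=|A_n(201)|$. -/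

import Mathlib

namespace Fishburn

/-- `π` is the one-line notation of a permutation of `{1, …, n}`. -/
def IsPermutation (n : ℕ) (π : List ℕ) : Prop :=
  π.Perm (List.range' 1 n)

/-- `π` has no entries `π_i`, `π_{i+1}`, `π_k` with `i + 1 < k`, `π_i = π_k + 1` and
`π_i < π_{i+1}`. -/
def AvoidsFishburnPattern (π : List ℕ) : Prop :=
  ∀ i j k : Fin π.length, (j : ℕ) = i + 1 → j < k →
    ¬ (π.get i = π.get k + 1 ∧ π.get i < π.get j)

/-- `π` is a Fishburn permutation of length `n`. -/
def IsFishburn (n : ℕ) (π : List ℕ) : Prop :=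
  IsPermutation n π ∧ AvoidsFishburnPattern π

/-- The sequence `α` contains `β`: some subsequence of `α` has the length and the relative
order of `β`. -/
def Contains (α β : List ℕ) : Prop :=
  ∃ f : Fin β.length → Fin α.length, StrictMono f ∧
    ∀ i j, α.get (f i) < α.get (f j) ↔ β.get i < β.get j

/-- The sequence `α` avoids `β`. -/
def Avoids (α β : List ℕ) : Prop := ¬ Contains α β

/-- The number of ascents of a sequence, that is, of pairs of consecutive entries `x`, `y` with
`x < y`. -/
def asc (a : List ℕ) : ℕ :=
  (a.zip a.tail).countP fun p => p.1 < p.2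

/-- `a` is an ascent sequence of length `n` (with entries indexed from `0`). -/
def IsAscentSequence (n : ℕ) (a : List ℕ) : Prop :=
  a.length = n ∧ ∀ i : Fin a.length,
    ((i : ℕ) = 0 → a.get i = 0) ∧ (1 ≤ (i : ℕ) → a.get i ≤ 1 + asc (a.take i))

instance (n : ℕ) (π : List ℕ) : Decidable (IsPermutation n π) := by
  unfold IsPermutation; infer_instance

instance (π : List ℕ) : Decidable (AvoidsFishburnPattern π) := by
  unfold AvoidsFishburnPattern; infer_instance

instance (n : ℕ) (π : List ℕ) : Decidable (IsFishburn n π) := by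
  unfold IsFishburn; infer_instance

/-- The sites of `σ` are numbered `0, …, σ.length`, where site `s` is the one with exactly `s`
entries to its left. For a permutation `σ` of `{1, …, m}`, site `s` is active if inserting
`m + 1` there gives a Fishburn permutation. -/
def IsActiveSite (σ : List ℕ) (s : ℕ) : Prop :=
  s ≤ σ.length ∧ IsFishburn (σ.length + 1) (σ.insertIdx s (σ.length + 1))

instance (σ : List ℕ) : DecidablePred (IsActiveSite σ) := fun s => by
  unfold IsActiveSite; infer_instance

/-- The label of an active site `s` of `σ`: the active sites are numbered from left to right,
starting with `0`, so it is the number of active sites to the left of `s`. -/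
def siteLabel (σ : List ℕ) (s : ℕ) : ℕ :=
  ((Finset.range s).filter (IsActiveSite σ)).card

/-- For a permutation `π` of `{1, …, n}`, the sequence of the labels of the sites into which
`1, …, n` are successively inserted to build `π`: the last step inserts `n` into
the permutation `σ` obtained from `π` by deleting `n`. -/
def insertionLabels : ℕ → List ℕ → List ℕ
  | 0, _ => []
  | n + 1, π =>
    insertionLabels n (π.erase (n + 1)) ++ [siteLabel (π.erase (n + 1)) (π.idxOf (n + 1))]

/-- The map of Bousquet-Mélou, Claesson, Dukes and Kitaev from Fishburn permutations to
ascent sequences. -/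
def g (π : List ℕ) : List ℕ := insertionLabels π.length π

/-- The set `F_n(σ)` of Fishburn permutations of length `n` that avoid `σ`. -/
def F (n : ℕ) (σ : List ℕ) : Set (List ℕ) := {π | IsFishburn n π ∧ Avoids π σ}

/-- The set `A_n(β)` of ascent sequences of length `n` that avoid `β`. -/
def A (n : ℕ) (β : List ℕ) : Set (List ℕ) := {α | IsAscentSequence n α ∧ Avoids α β}

end Fishburn

namespace Fishburn

/-- The value `y` is linked if it is `1` or stands to the right of `y - 1`, where `p` gives the
positions of the values. -/
def IsLinked (p : ℕ → ℕ) (y : ℕ) : Prop := y = 1 ∨ p (y - 1) < p y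

instance (p : ℕ → ℕ) : DecidablePred (IsLinked p) := fun y => by
  unfold IsLinked; infer_instance

/-- The linked values smaller than `t` that stand to the left of `t`. -/
def linkedLeft (p : ℕ → ℕ) (t : ℕ) : Finset ℕ :=
  (Finset.Ico 1 t).filter fun y => IsLinked p y ∧ p y < p t

/-- The number of linked values smaller than `t` that stand to the left of `t`. -/
def posLabel (p : ℕ → ℕ) (t : ℕ) : ℕ := (linkedLeft p t).card

theorem mem_linkedLeft {p : ℕ → ℕ} {t y : ℕ} :
    y ∈ linkedLeft p t ↔ (1 ≤ y ∧ y < t) ∧ IsLinked p y ∧ p y < p t := by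
  simp [linkedLeft]

/-- The values `1, …, n` have distinct positions, and whenever `d` has a smaller value `c` to its
left, there is a linked value smaller than `d` from `c` on and left of `d`. -/
structure IsFishburnPosition (n : ℕ) (p : ℕ → ℕ) : Prop where
  injOn : Set.InjOn p (Set.Icc 1 n)
  exists_linked : ∀ c d, 1 ≤ c → c < d → d ≤ n → p c < p d →
    ∃ y, 1 ≤ y ∧ y < d ∧ IsLinked p y ∧ p c ≤ p y ∧ p y < p d

namespace IsFishburnPosition

variable {n : ℕ} {p : ℕ → ℕ}

theorem lt_or_lt (h : IsFishburnPosition n p) {x y : ℕ} (hx : 1 ≤ x) (hxn : x ≤ n) (hy : 1 ≤ y)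
    (hyn : y ≤ n) (hxy : x ≠ y) : p x < p y ∨ p y < p x :=
  lt_or_gt_of_ne fun he => hxy (h.injOn ⟨hx, hxn⟩ ⟨hy, hyn⟩ he)

theorem posLabel_lt_posLabel (h : IsFishburnPosition n p) {c d : ℕ} (hc : 1 ≤ c) (hcd : c < d)
    (hd : d ≤ n) (hp : p c < p d) : posLabel p c < posLabel p d := by
  obtain ⟨y, hy1, hyd, hy, hcy, hyp⟩ := h.exists_linked c d hc hcd hd hp
  apply Finset.card_lt_card
  refine Finset.ssubset_iff_of_subset (fun z hz => ?_) |>.2 ⟨y, ?_, ?_⟩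
  · rw [mem_linkedLeft] at hz ⊢
    exact ⟨⟨hz.1.1, by omega⟩, hz.2.1, by omega⟩
  · exact mem_linkedLeft.2 ⟨⟨hy1, hyd⟩, hy, hyp⟩
  · rw [mem_linkedLeft]
    omega

theorem posLabel_lt_posLabel_succ_iff (h : IsFishburnPosition n p) {t : ℕ} (ht : 1 ≤ t)
    (htn : t + 1 ≤ n) : posLabel p t < posLabel p (t + 1) ↔ p t < p (t + 1) := by
  refine ⟨fun hl => ?_, h.posLabel_lt_posLabel ht (by omega) htn⟩
  by_contra hp
  refine absurd hl (not_lt.2 (Finset.card_le_card fun z hz => ?_))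
  rw [mem_linkedLeft] at hz ⊢
  have hzt : z ≠ t := by rintro rfl; omega
  exact ⟨⟨hz.1.1, by omega⟩, hz.2.1, by omega⟩

theorem exists_pattern_of_posLabel (h : IsFishburnPosition n p) {i j k : ℕ} (hij : i < j)
    (hjk : j < k) (hk : k ≤ n) (hl : posLabel p j < posLabel p k)
    (hl' : posLabel p k < posLabel p i) :
    ∃ a b c d, 1 ≤ a ∧ a < b ∧ b < c ∧ c < d ∧ d ≤ n ∧ p c < p d ∧ p d < p a ∧ p a < p b := by
  obtain ⟨v, hvi, hvk⟩ := Finset.exists_mem_notMem_of_card_lt_card hl'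
  rw [mem_linkedLeft] at hvi hvk
  have hkv : p k < p v := by
    rcases h.lt_or_lt (x := k) (y := v) (by omega) hk hvi.1.1 (by omega) (by omega) with h' | h'
    · exact h'
    · exact absurd ⟨⟨hvi.1.1, by omega⟩, hvi.2.1, h'⟩ hvk
  obtain ⟨c, hic, hck, hlc, hmax⟩ : ∃ c, i < c ∧ c < k ∧ posLabel p c < posLabel p k ∧
      ∀ y, c < y → y < k → posLabel p k ≤ posLabel p y := by
    let P : ℕ → Prop := fun c => i < c ∧ c < k ∧ posLabel p c < posLabel p k
    have hP : P (Nat.findGreatest P k) := Nat.findGreatest_spec hjk.le ⟨hij, hjk, hl⟩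
    refine ⟨_, hP.1, hP.2.1, hP.2.2, fun y hy hyk => ?_⟩
    by_contra hlt
    exact Nat.findGreatest_is_greatest hy hyk.le ⟨hP.1.trans hy, hyk, not_le.1 hlt⟩
  refine ⟨v, i, c, k, hvi.1.1, hvi.1.2, hic, hck, hk, ?_, hkv, hvi.2.2⟩
  obtain ⟨y, hyk, hyc⟩ := Finset.exists_mem_notMem_of_card_lt_card hlc
  rw [mem_linkedLeft] at hyk hyc
  rcases lt_trichotomy y c with hlt | rfl | hgt
  · rcases h.lt_or_lt (x := c) (y := y) (by omega) (by omega) hyk.1.1 (by omega) (by omega)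
      with h' | h'
    · exact h'.trans hyk.2.2
    · exact absurd ⟨⟨hyk.1.1, hlt⟩, hyk.2.1, h'⟩ hyc
  · exact hyk.2.2
  · exact absurd (hmax y hgt hyk.1.2)
      (not_le.2 (h.posLabel_lt_posLabel hyk.1.1 hyk.1.2 hk hyk.2.2))

theorem exists_posLabel_of_pattern (h : IsFishburnPosition n p)
    (hpat : ∃ a b c d, 1 ≤ a ∧ a < b ∧ b < c ∧ c < d ∧ d ≤ n ∧ p c < p d ∧ p d < p a ∧ p a < p b) :
    ∃ i j k, 1 ≤ i ∧ i < j ∧ j < k ∧ k ≤ n ∧ posLabel p j < posLabel p k ∧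
      posLabel p k < posLabel p i := by
  classical
  have hex : ∃ d c a b, 1 ≤ a ∧ a < b ∧ b < c ∧ c < d ∧ d ≤ n ∧
      p c < p d ∧ p d < p a ∧ p a < p b := by
    obtain ⟨a, b, c, d, h'⟩ := hpat
    exact ⟨d, c, a, b, h'⟩
  have hmin : ∀ e < Nat.find hex, _ := fun e he => Nat.find_min hex he
  have hex' := Nat.find_spec hex
  generalize Nat.find hex = d at hmin hex'
  have hmin' : ∀ e < Nat.find hex', _ := fun e he => Nat.find_min hex' he
  have hspec := Nat.find_spec hex'
  generalize Nat.find hex' = c at hmin' hspec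
  obtain ⟨a, b, ha, hab, hbc, hcd, hd, h1, h2, h3⟩ := hspec
  refine ⟨b, c, d, by omega, hbc, hcd, hd, h.posLabel_lt_posLabel (by omega) hcd hd h1, ?_⟩
  obtain ⟨y, hy1, hyb, hy, hay, hyp⟩ := h.exists_linked a b ha hab (by omega) h3
  have hright : ∀ w, b ≤ w → w < c → p d < p w := by
    intro w hbw hwc
    rcases hbw.eq_or_lt with rfl | hbw
    · omega
    rcases h.lt_or_lt (x := d) (y := w) (by omega) hd (by omega) (by omega) (by omega) with h' | h'
    · exact h'
    · exact absurd ⟨a, b, ha, hab, hbw, by omega, hd, h', h2, h3⟩ (hmin' w hwc)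
  apply Finset.card_lt_card
  refine Finset.ssubset_iff_of_subset (fun w hw => ?_) |>.2 ⟨y, ?_, ?_⟩
  · rw [mem_linkedLeft] at hw ⊢
    obtain ⟨⟨hw1, hwd⟩, hwl, hwp⟩ := hw
    refine ⟨⟨hw1, ?_⟩, hwl, by omega⟩
    by_contra hbw
    rcases lt_trichotomy w c with hwc | rfl | hcw
    · have := hright w (by omega) hwc
      omega
    · have := hright (w - 1) (by omega) (by omega)
      rcases hwl with hwl | hwl <;> omega
    · refine hmin w hwd ⟨w - 1, a, b, ha, hab, by omega, by omega, by omega, ?_, by omega, h3⟩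
      rcases hwl with hwl | hwl
      · omega
      · exact hwl
  · exact mem_linkedLeft.2 ⟨⟨hy1, hyb⟩, hy, hyp⟩
  · rw [mem_linkedLeft]
    omega

end IsFishburnPosition

theorem avoidsFishburnPattern_iff_getElem {π : List ℕ} :
    AvoidsFishburnPattern π ↔ ∀ i k, (hk : k < π.length) → (hi : i + 1 < k) →
      ¬ (π[i] = π[k] + 1 ∧ π[i] < π[i + 1]) := by
  constructor
  · intro h i k hk hi
    exact h ⟨i, by omega⟩ ⟨i + 1, by omega⟩ ⟨k, hk⟩ rfl hi
  · rintro h ⟨i, hi⟩ ⟨j, hj⟩ ⟨k, hk⟩ hij hjk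
    simp only [Fin.mk_lt_mk] at hij hjk
    subst hij
    exact h i k hk hjk

theorem avoidsFishburnPattern_nil : AvoidsFishburnPattern [] := by
  rintro ⟨i, hi⟩
  simp at hi

theorem avoidsFishburnPattern_cons {x : ℕ} {l : List ℕ} :
    AvoidsFishburnPattern (x :: l) ↔ AvoidsFishburnPattern l ∧
      ∀ z v, l = z :: v → x < z → ∀ w ∈ v, x ≠ w + 1 := by
  simp only [avoidsFishburnPattern_iff_getElem]
  constructor
  · refine fun h => ⟨fun i k hk hi => ?_, ?_⟩
    · exact h (i + 1) (k + 1) (by simpa using hk) (by omega)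
    · rintro z v rfl hxz w hw hxw
      obtain ⟨k, hk, rfl⟩ := List.getElem_of_mem hw
      exact h 0 (k + 2) (by simpa using hk) (by omega) (by simpa using ⟨hxw, hxz⟩)
  · rintro ⟨h, h0⟩ i k hk hi ⟨h1, h2⟩
    obtain ⟨k, rfl⟩ : ∃ k', k = k' + 1 := ⟨k - 1, by omega⟩
    cases i with
    | zero =>
      cases l with
      | nil => simp at hk
      | cons z v =>
        obtain ⟨k, rfl⟩ : ∃ k', k = k' + 1 := ⟨k - 1, by omega⟩
        simp only [List.length_cons] at hk
        exact h0 z v rfl (by simpa using h2) v[k] (List.getElem_mem _) (by simpa using h1)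
    | succ i =>
      simp only [List.length_cons] at hk
      exact h i k (by omega) (by omega) ⟨by simpa using h1, by simpa using h2⟩

/-- Inserting a new maximum `N` between `u` and `v`. -/
theorem avoidsFishburnPattern_insert {u v : List ℕ} {N : ℕ} (hN : ∀ x ∈ u ++ v, x < N) :
    AvoidsFishburnPattern (u ++ N :: v) ↔ AvoidsFishburnPattern (u ++ v) ∧
      ∀ x ∈ u.getLast?, ∀ w ∈ v, x ≠ w + 1 := by
  induction u with
  | nil =>
    simp only [List.nil_append, avoidsFishburnPattern_cons, List.getLast?_nil]
    refine ⟨fun h => ⟨h.1, by simp⟩, fun h => ⟨h.1, ?_⟩⟩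
    rintro z l rfl hz
    have := hN z (by simp)
    omega
  | cons x u ih =>
    have ih := ih fun y hy => hN y (by simp at hy ⊢; tauto)
    have hx := hN x (by simp)
    rw [List.cons_append, List.cons_append, avoidsFishburnPattern_cons, ih,
      avoidsFishburnPattern_cons]
    cases u with
    | nil =>
      simp only [List.nil_append, List.cons.injEq, List.getLast?_nil, List.getLast?_singleton]
      constructor
      · rintro ⟨⟨h1, -⟩, h2⟩
        have h3 := h2 N v ⟨rfl, rfl⟩ hx
        refine ⟨⟨h1, ?_⟩, ?_⟩
        · rintro z l rfl - w hw
          exact h3 w (by simp [hw])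
        · rintro y hy
          simp only [Option.mem_def, Option.some.injEq] at hy
          rwa [← hy]
      · rintro ⟨⟨h1, h2⟩, h3⟩
        refine ⟨⟨h1, by simp⟩, ?_⟩
        rintro z l ⟨rfl, rfl⟩ -
        exact h3 x rfl
    | cons x' u =>
      simp only [List.cons_append, List.cons.injEq, List.getLast?_cons_cons]
      constructor
      · rintro ⟨⟨h1, h2⟩, h3⟩
        refine ⟨⟨h1, ?_⟩, h2⟩
        rintro z l ⟨rfl, rfl⟩ hz w hw
        refine h3 _ _ ⟨rfl, rfl⟩ hz w ?_
        simp at hw ⊢; tauto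
      · rintro ⟨⟨h1, h2⟩, h3⟩
        refine ⟨⟨h1, h3⟩, ?_⟩
        rintro z l ⟨rfl, rfl⟩ hz w hw
        simp only [List.mem_append, List.mem_cons] at hw
        rcases hw with hw | rfl | hw
        · exact h2 _ _ ⟨rfl, rfl⟩ hz w (by simp [hw])
        · omega
        · exact h2 _ _ ⟨rfl, rfl⟩ hz w (by simp [hw])

namespace IsPermutation

variable {n : ℕ} {π : List ℕ}

theorem length_eq (h : IsPermutation n π) : π.length = n := by
  simpa using List.Perm.length_eq h

theorem mem_iff (h : IsPermutation n π) {x : ℕ} : x ∈ π ↔ 1 ≤ x ∧ x ≤ n := by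
  rw [List.Perm.mem_iff h, List.mem_range'_1]
  omega

theorem nodup (h : IsPermutation n π) : π.Nodup :=
  (List.Perm.nodup_iff h).2 List.nodup_range'

theorem idxOf_lt (h : IsPermutation n π) {x : ℕ} (h1 : 1 ≤ x) (hn : x ≤ n) : π.idxOf x < n := by
  rw [← h.length_eq, List.idxOf_lt_length_iff]
  exact h.mem_iff.2 ⟨h1, hn⟩

theorem insert_iff {u v : List ℕ} :
    IsPermutation (n + 1) (u ++ (n + 1) :: v) ↔ IsPermutation n (u ++ v) := by
  unfold IsPermutation
  have h1 : List.range' 1 (n + 1) = List.range' 1 n ++ [n + 1] := by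
    rw [List.range'_concat]; simp [add_comm]
  have h2 := (List.perm_append_singleton (n + 1) (List.range' 1 n)).symm
  rw [h1]
  constructor
  · intro h
    exact (List.perm_cons (n + 1)).1 ((List.perm_middle.symm.trans h).trans h2.symm)
  · intro h
    exact (List.perm_middle.trans (h.cons _)).trans h2

theorem exists_eq_insert (h : IsPermutation (n + 1) π) :
    ∃ u v, π = u ++ (n + 1) :: v ∧ IsPermutation n (u ++ v) := by
  obtain ⟨u, v, rfl⟩ := List.append_of_mem (h.mem_iff.2 ⟨by omega, le_refl (n + 1)⟩)
  exact ⟨u, v, rfl, insert_iff.1 h⟩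

end IsPermutation

theorem isFishburn_insert_iff {n : ℕ} {u v : List ℕ} :
    IsFishburn (n + 1) (u ++ (n + 1) :: v) ↔ IsFishburn n (u ++ v) ∧
      ∀ x ∈ u.getLast?, ∀ w ∈ v, x ≠ w + 1 := by
  unfold IsFishburn
  rw [IsPermutation.insert_iff, and_assoc]
  refine and_congr_right fun h => avoidsFishburnPattern_insert fun x hx => ?_
  have := h.mem_iff.1 hx
  omega

theorem IsFishburn.exists_eq_insert {n : ℕ} {π : List ℕ} (h : IsFishburn (n + 1) π) :
    ∃ u v, π = u ++ (n + 1) :: v ∧ IsFishburn n (u ++ v) := by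
  obtain ⟨u, v, rfl, -⟩ := h.1.exists_eq_insert
  exact ⟨u, v, rfl, (isFishburn_insert_iff.1 h).1⟩

theorem idxOf_insert {u v : List ℕ} {N : ℕ} (hN : N ∉ u) : (u ++ N :: v).idxOf N = u.length := by
  simp [List.idxOf_append, hN]

theorem erase_insert {u v : List ℕ} {N : ℕ} (hN : N ∉ u) : (u ++ N :: v).erase N = u ++ v := by
  simp [List.erase_append_right _ hN]

/-- Deleting the entry `N` keeps the relative positions of the other values. -/
theorem idxOf_lt_idxOf_insert_iff {u v : List ℕ} {N y z : ℕ} (hy : y ≠ N) (hz : z ≠ N) :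
    (u ++ N :: v).idxOf y < (u ++ N :: v).idxOf z ↔ (u ++ v).idxOf y < (u ++ v).idxOf z := by
  have hy' := fun h => List.idxOf_lt_length_of_mem (a := y) (l := u) h
  have hz' := fun h => List.idxOf_lt_length_of_mem (a := z) (l := u) h
  simp only [List.idxOf_append, List.idxOf_cons_ne _ hy.symm, List.idxOf_cons_ne _ hz.symm]
  split_ifs <;> grind

theorem idxOf_insert_lt_length_iff {u v : List ℕ} {N y : ℕ} (hy : y ≠ N) :
    (u ++ N :: v).idxOf y < u.length ↔ (u ++ v).idxOf y < u.length := by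
  have hy' := fun h => List.idxOf_lt_length_of_mem (a := y) (l := u) h
  simp only [List.idxOf_append, List.idxOf_cons_ne _ hy.symm]
  split_ifs <;> grind

theorem IsFishburn.isFishburnPosition {n : ℕ} {π : List ℕ} (h : IsFishburn n π) :
    IsFishburnPosition n fun x => π.idxOf x := by
  have hlen := h.1.length_eq
  refine ⟨fun x hx y hy hxy => (List.idxOf_inj (h.1.mem_iff.2 hx)).1 hxy, ?_⟩
  intro c d hc hcd hd hp
  replace hp : π.idxOf c < π.idxOf d := hp
  obtain ⟨y, hy, hmax⟩ := Finset.exists_max_image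
    ((Finset.Ico 1 d).filter fun y => π.idxOf y < π.idxOf d) (fun y => π.idxOf y)
    ⟨c, by simp [hc, hcd, hp]⟩
  simp only [Finset.mem_filter, Finset.mem_Ico] at hy hmax
  refine ⟨y, hy.1.1, hy.1.2, ?_, hmax c ⟨⟨hc, hcd⟩, hp⟩, hy.2⟩
  by_contra hl
  simp only [IsLinked, not_or, not_lt] at hl
  obtain ⟨hy1, hl⟩ := hl
  have hmem : ∀ x, 1 ≤ x → x ≤ d → x ∈ π := fun x h1 h2 => h.1.mem_iff.2 ⟨h1, by omega⟩
  have hyl := List.idxOf_lt_length_of_mem (hmem y hy.1.1 hy.1.2.le)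
  have hzl := List.idxOf_lt_length_of_mem (hmem (y - 1) (by omega) (by omega))
  have hdl := List.idxOf_lt_length_of_mem (hmem d (by omega) le_rfl)
  have hne : π.idxOf y ≠ π.idxOf (y - 1) := fun he => by
    have := (List.idxOf_inj (hmem y hy.1.1 hy.1.2.le)).1 he
    omega
  have hne' : π.idxOf d ≠ π.idxOf (y - 1) := fun he => by
    have := (List.idxOf_inj (hmem d (by omega) le_rfl)).1 he
    omega
  have hd' : π.idxOf d < π.idxOf (y - 1) := by
    by_contra hlt
    have := hmax (y - 1) ⟨⟨by omega, by omega⟩, by omega⟩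
    omega
  refine avoidsFishburnPattern_iff_getElem.1 h.2 (π.idxOf y) (π.idxOf (y - 1)) hzl (by omega) ?_
  rw [List.getElem_idxOf, List.getElem_idxOf]
  refine ⟨by omega, ?_⟩
  set z := π[π.idxOf y + 1]'(by omega) with hz
  have hzi : π.idxOf z = π.idxOf y + 1 := h.1.nodup.idxOf_getElem _ _
  have hz1 := h.1.mem_iff.1 (List.getElem_mem (l := π) (n := π.idxOf y + 1) (by omega))
  by_contra hlt
  have hzd : z ≠ d := by omega
  have hzd' : π.idxOf z ≠ π.idxOf d := fun he =>
    hzd ((List.idxOf_inj (List.getElem_mem _)).1 he)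
  have := hmax z ⟨⟨by omega, by omega⟩, by omega⟩
  omega

theorem insertIdx_eq_take_append_cons_drop {α : Type*} {l : List α} {s : ℕ} (hs : s ≤ l.length)
    (a : α) : l.insertIdx s a = l.take s ++ a :: l.drop s := by
  induction l generalizing s with
  | nil =>
    obtain rfl : s = 0 := by simpa using hs
    rfl
  | cons b l ih =>
    cases s with
    | zero => rfl
    | succ s => simpa using ih (by simpa using hs)

theorem isFishburn_nil_iff {π : List ℕ} : IsFishburn 0 π ↔ π = [] := by
  constructor
  · intro h
    exact List.length_eq_zero_iff.1 h.1.length_eq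
  · rintro rfl
    exact ⟨List.Perm.refl _, avoidsFishburnPattern_nil⟩

namespace IsFishburn

variable {n : ℕ} {σ : List ℕ}

theorem isActiveSite_iff (h : IsFishburn n σ) {s : ℕ} :
    IsActiveSite σ s ↔ s ≤ n ∧ ∀ x ∈ (σ.take s).getLast?, ∀ w ∈ σ.drop s, x ≠ w + 1 := by
  unfold IsActiveSite
  rw [h.1.length_eq]
  refine and_congr_right fun hs => ?_
  rw [insertIdx_eq_take_append_cons_drop (by rw [h.1.length_eq]; exact hs), isFishburn_insert_iff,
    List.take_append_drop]
  exact and_iff_right h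

theorem isActiveSite_zero (h : IsFishburn n σ) : IsActiveSite σ 0 :=
  h.isActiveSite_iff.2 ⟨by omega, by simp⟩

theorem isActiveSite_succ_iff (h : IsFishburn n σ) {s : ℕ} (hs : s < σ.length) :
    IsActiveSite σ (s + 1) ↔ IsLinked (fun x => σ.idxOf x) σ[s] := by
  have hlen := h.1.length_eq
  have hmem := h.1.mem_iff.1 (List.getElem_mem hs)
  have hidx : σ.idxOf σ[s] = s := h.1.nodup.idxOf_getElem _ _
  have hlast : (σ.take (s + 1)).getLast? = some σ[s] := by
    rw [List.getLast?_eq_getElem?]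
    simp [Nat.min_eq_left (show s + 1 ≤ σ.length from hs)]
  rw [h.isActiveSite_iff, hlast]
  simp only [Option.mem_def, Option.some.injEq, forall_eq', IsLinked, hidx]
  constructor
  · rintro ⟨-, h2⟩
    by_contra! hcon
    have hm : σ[s] - 1 ∈ σ := h.1.mem_iff.2 (by omega)
    have hne : σ.idxOf (σ[s] - 1) ≠ s := fun he => by
      have := (List.idxOf_inj hm).1 (he.trans hidx.symm)
      omega
    refine h2 (σ[s] - 1) ?_ (by omega)
    rw [List.mem_drop_iff_getElem]
    have hl := List.idxOf_lt_length_of_mem hm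
    refine ⟨σ.idxOf (σ[s] - 1) - (s + 1), by omega, ?_⟩
    have : s + 1 + (σ.idxOf (σ[s] - 1) - (s + 1)) = σ.idxOf (σ[s] - 1) := by omega
    simp only [this, List.getElem_idxOf]
  · refine fun h2 => ⟨by omega, fun w hw hxw => ?_⟩
    obtain ⟨i, hi, rfl⟩ := List.mem_drop_iff_getElem.1 hw
    have hw' := h.1.mem_iff.1 (List.getElem_mem (l := σ) (n := s + 1 + i) (by omega))
    have hiw : σ.idxOf (σ[s + 1 + i]) = s + 1 + i := h.1.nodup.idxOf_getElem _ _
    rw [hxw, Nat.add_sub_cancel, hiw] at h2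
    omega

end IsFishburn

/-- The linked values among the first `s` entries of a permutation `σ` of `{1, …, n}`. -/
def linkedBefore (n : ℕ) (σ : List ℕ) (s : ℕ) : Finset ℕ :=
  (Finset.Ico 1 (n + 1)).filter fun y => IsLinked (fun x => σ.idxOf x) y ∧ σ.idxOf y < s

theorem siteLabel_zero (σ : List ℕ) : siteLabel σ 0 = 0 := by
  simp [siteLabel]

theorem siteLabel_succ (σ : List ℕ) (s : ℕ) :
    siteLabel σ (s + 1) = siteLabel σ s + if IsActiveSite σ s then 1 else 0 := by
  unfold siteLabel
  rw [Finset.range_add_one, Finset.filter_insert]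
  split_ifs <;> simp

theorem siteLabel_mono (σ : List ℕ) : Monotone (siteLabel σ) :=
  monotone_nat_of_le_succ fun s => by rw [siteLabel_succ]; omega

theorem siteLabel_lt_of_isActiveSite {σ : List ℕ} {s t : ℕ} (hs : IsActiveSite σ s) (hst : s < t) :
    siteLabel σ s < siteLabel σ t := by
  have := siteLabel_mono σ (show s + 1 ≤ t from hst)
  rw [siteLabel_succ, if_pos hs] at this
  omega

theorem exists_isActiveSite_of_lt_siteLabel {σ : List ℕ} {a t : ℕ} (h : a < siteLabel σ t) :
    ∃ s, IsActiveSite σ s ∧ siteLabel σ s = a := by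
  induction t with
  | zero => simp [siteLabel_zero] at h
  | succ t ih =>
    by_cases ha : a < siteLabel σ t
    · exact ih ha
    · rw [siteLabel_succ] at h
      split_ifs at h with hs
      · exact ⟨t, hs, by omega⟩
      · omega

namespace IsFishburn

variable {n : ℕ} {σ : List ℕ}

theorem siteLabel_succ_eq (h : IsFishburn n σ) {s : ℕ} (hs : s ≤ n) :
    siteLabel σ (s + 1) = 1 + (linkedBefore n σ s).card := by
  induction s with
  | zero => simp [siteLabel_succ, siteLabel_zero, h.isActiveSite_zero, linkedBefore]
  | succ s ih =>
    have hlt : s < σ.length := by rw [h.1.length_eq]; omega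
    have hidx : σ.idxOf σ[s] = s := h.1.nodup.idxOf_getElem _ _
    have hmem := h.1.mem_iff.1 (List.getElem_mem hlt)
    have key : ∀ y, 1 ≤ y → y ≤ n → (σ.idxOf y < s + 1 ↔ y = σ[s] ∨ σ.idxOf y < s) := by
      intro y h1 h2
      have : σ.idxOf y = s ↔ y = σ[s] := by
        rw [← List.idxOf_inj (h.1.mem_iff.2 ⟨h1, h2⟩), hidx]
      rw [← this]
      omega
    rw [siteLabel_succ, ih (by omega), add_assoc]
    congr 1
    simp only [h.isActiveSite_succ_iff hlt]
    split_ifs with hl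
    · rw [← Finset.card_insert_of_notMem (a := σ[s]) (by simp [linkedBefore, hidx])]
      congr 1
      ext y
      simp only [linkedBefore, Finset.mem_insert, Finset.mem_filter, Finset.mem_Ico]
      constructor
      · rintro (rfl | hy)
        · exact ⟨by omega, hl, by omega⟩
        · exact ⟨hy.1, hy.2.1, by omega⟩
      · rintro ⟨hy1, hy2, hy3⟩
        rcases (key y hy1.1 (by omega)).1 hy3 with rfl | hy
        · exact Or.inl rfl
        · exact Or.inr ⟨hy1, hy2, hy⟩
    · rw [add_zero]
      congr 1
      ext y
      simp only [linkedBefore, Finset.mem_filter, Finset.mem_Ico]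
      refine and_congr_right fun hy1 => and_congr_right fun hy2 => ?_
      rw [key y hy1.1 (by omega)]
      refine ⟨Or.inr, ?_⟩
      rintro (rfl | hy)
      · exact absurd hy2 hl
      · exact hy

theorem siteLabel_eq (h : IsFishburn n σ) {s : ℕ} (hs : IsActiveSite σ s) :
    siteLabel σ s = (linkedBefore n σ s).card := by
  have h1 := siteLabel_succ σ s
  rw [if_pos hs, h.siteLabel_succ_eq (h.isActiveSite_iff.1 hs).1] at h1
  omega

end IsFishburn

theorem isActiveSite_of_isFishburn_insert {n : ℕ} {u v : List ℕ}
    (h : IsFishburn (n + 1) (u ++ (n + 1) :: v)) : IsActiveSite (u ++ v) u.length := by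
  obtain ⟨h1, h2⟩ := isFishburn_insert_iff.1 h
  refine h1.isActiveSite_iff.2 ⟨?_, by simpa using h2⟩
  have := h1.1.length_eq
  rw [List.length_append] at this
  omega

theorem isLinked_insert_iff {u v : List ℕ} {N y : ℕ} (hy : y < N) :
    IsLinked (fun x => (u ++ N :: v).idxOf x) y ↔ IsLinked (fun x => (u ++ v).idxOf x) y := by
  unfold IsLinked
  rw [idxOf_lt_idxOf_insert_iff (by omega) (by omega)]

theorem posLabel_insert {u v : List ℕ} {N t : ℕ} (ht : t < N) :
    posLabel (fun x => (u ++ N :: v).idxOf x) t = posLabel (fun x => (u ++ v).idxOf x) t := by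
  unfold posLabel linkedLeft
  congr 1
  refine Finset.filter_congr fun y hy => ?_
  rw [Finset.mem_Ico] at hy
  rw [isLinked_insert_iff (by omega), idxOf_lt_idxOf_insert_iff (by omega) (by omega)]

theorem posLabel_insert_self {n : ℕ} {u v : List ℕ} (hu : n + 1 ∉ u) :
    posLabel (fun x => (u ++ (n + 1) :: v).idxOf x) (n + 1) =
      (linkedBefore n (u ++ v) u.length).card := by
  unfold posLabel linkedLeft linkedBefore
  congr 1
  refine Finset.filter_congr fun y hy => ?_
  rw [Finset.mem_Ico] at hy
  beta_reduce
  rw [isLinked_insert_iff (by omega), idxOf_insert hu, idxOf_insert_lt_length_iff (by omega)]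

theorem IsPermutation.notMem_left {n : ℕ} {u v : List ℕ} (h : IsPermutation n (u ++ v)) :
    n + 1 ∉ u := fun hm => by
  have := h.mem_iff.1 (List.mem_append_left v hm)
  omega

theorem insertionLabels_insert {n : ℕ} {u v : List ℕ} (h : IsPermutation n (u ++ v)) :
    insertionLabels (n + 1) (u ++ (n + 1) :: v) =
      insertionLabels n (u ++ v) ++ [siteLabel (u ++ v) u.length] := by
  rw [insertionLabels, erase_insert h.notMem_left, idxOf_insert h.notMem_left]

theorem g_insert {n : ℕ} {u v : List ℕ} (h : IsPermutation n (u ++ v)) :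
    g (u ++ (n + 1) :: v) = g (u ++ v) ++ [siteLabel (u ++ v) u.length] := by
  unfold g
  rw [(IsPermutation.insert_iff.2 h).length_eq, h.length_eq, insertionLabels_insert h]

theorem IsFishburn.g_eq_map {n : ℕ} {π : List ℕ} (h : IsFishburn n π) :
    g π = (List.range' 1 n).map (posLabel fun x => π.idxOf x) := by
  induction n generalizing π with
  | zero =>
    obtain rfl := isFishburn_nil_iff.1 h
    rfl
  | succ n ih =>
    obtain ⟨u, v, rfl, h'⟩ := h.exists_eq_insert
    rw [g_insert h'.1, ih h', List.range'_concat, List.map_append, List.map_singleton, one_mul,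
      add_comm 1 n, posLabel_insert_self h'.1.notMem_left,
      h'.siteLabel_eq (isActiveSite_of_isFishburn_insert h)]
    congr 1
    refine List.map_congr_left fun t ht => ?_
    rw [List.mem_range'_1] at ht
    rw [posLabel_insert (by omega)]

theorem IsFishburn.g_injective {n : ℕ} {π π' : List ℕ} (h : IsFishburn n π) (h' : IsFishburn n π')
    (hg : g π = g π') : π = π' := by
  induction n generalizing π π' with
  | zero => rw [isFishburn_nil_iff.1 h, isFishburn_nil_iff.1 h']
  | succ n ih =>
    obtain ⟨u, v, rfl, hσ⟩ := h.exists_eq_insert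
    obtain ⟨u', v', rfl, hσ'⟩ := h'.exists_eq_insert
    rw [g_insert hσ.1, g_insert hσ'.1] at hg
    obtain ⟨hg, hl⟩ := List.append_inj' hg rfl
    have hs := ih hσ hσ' hg
    have ha := isActiveSite_of_isFishburn_insert h
    have ha' := isActiveSite_of_isFishburn_insert h'
    rw [List.singleton_inj, hs] at hl
    rw [hs] at ha
    have hlen : u.length = u'.length := by
      rcases lt_trichotomy u.length u'.length with hlt | he | hlt
      · have := siteLabel_lt_of_isActiveSite ha hlt
        omega
      · exact he
      · have := siteLabel_lt_of_isActiveSite ha' hlt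
        omega
    obtain ⟨rfl, rfl⟩ := List.append_inj hs hlen
    rfl

theorem asc_append_pair (l : List ℕ) (x y : ℕ) :
    asc (l ++ [x, y]) = asc (l ++ [x]) + if x < y then 1 else 0 := by
  induction l with
  | nil => simp [asc, List.countP_cons]
  | cons a l ih =>
    cases l with
    | nil => simp [asc, List.countP_cons]; omega
    | cons b l =>
      simp only [asc, List.cons_append, List.tail_cons, List.zip_cons_cons, List.countP_cons]
        at ih ⊢
      omega

/-- The number of linked values in `{1, …, m}` is one more than the number of ascents of the
sequence of the first `m` labels. -/
theorem IsFishburnPosition.card_filter_isLinked {n : ℕ} {p : ℕ → ℕ} (h : IsFishburnPosition n p)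
    {m : ℕ} (hm : m + 1 ≤ n) : ((Finset.Ico 1 (m + 2)).filter (IsLinked p)).card =
      1 + asc ((List.range' 1 (m + 1)).map (posLabel p)) := by
  induction m with
  | zero =>
    rw [Finset.filter_true_of_mem] <;> simp [asc, IsLinked]
  | succ m ih =>
    have hr : (List.range' 1 (m + 1 + 1)).map (posLabel p) =
        (List.range' 1 m).map (posLabel p) ++ [posLabel p (m + 1), posLabel p (m + 1 + 1)] := by
      rw [List.range'_concat, List.range'_concat]
      simp [add_comm 1]
    have hr' : (List.range' 1 (m + 1)).map (posLabel p) =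
        (List.range' 1 m).map (posLabel p) ++ [posLabel p (m + 1)] := by
      rw [List.range'_concat]
      simp [add_comm 1]
    rw [hr, asc_append_pair, ← hr', ← add_assoc, ← ih (by omega),
      show m + 1 + 2 = m + 2 + 1 from rfl, ← Finset.insert_Ico_right_eq_Ico_add_one (by omega),
      Finset.filter_insert]
    have : IsLinked p (m + 2) ↔ p (m + 1) < p (m + 1 + 1) := by
      simp [IsLinked]
    simp only [h.posLabel_lt_posLabel_succ_iff (by omega) hm, ← this]
    split_ifs <;> simp

theorem IsFishburn.isAscentSequence_g {n : ℕ} {π : List ℕ} (h : IsFishburn n π) :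
    IsAscentSequence n (g π) := by
  have hp := h.isFishburnPosition
  rw [h.g_eq_map]
  refine ⟨by simp, ?_⟩
  rintro ⟨i, hi⟩
  simp only [List.length_map, List.length_range'] at hi
  simp only [List.get_eq_getElem, List.getElem_map, List.getElem_range', one_mul]
  constructor
  · rintro rfl
    simp [posLabel, linkedLeft]
  · intro hi1
    obtain ⟨m, rfl⟩ : ∃ m, i = m + 1 := ⟨i - 1, by omega⟩
    rw [← List.map_take, List.take_range'_of_length_ge hi.le,
      ← hp.card_filter_isLinked (by omega)]
    refine Finset.card_le_card fun y hy => ?_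
    rw [mem_linkedLeft] at hy
    simp only [Finset.mem_filter, Finset.mem_Ico]
    exact ⟨by omega, hy.2.1⟩

theorem IsFishburn.siteLabel_length {n : ℕ} {σ : List ℕ} (h : IsFishburn (n + 1) σ) :
    siteLabel σ (n + 2) = 2 + asc (g σ) := by
  rw [h.siteLabel_succ_eq le_rfl, h.g_eq_map]
  have hc := h.isFishburnPosition.card_filter_isLinked (m := n) le_rfl
  have : linkedBefore (n + 1) σ (n + 1) =
      (Finset.Ico 1 (n + 2)).filter (IsLinked fun x => σ.idxOf x) := by
    refine Finset.filter_congr fun y hy => and_iff_left ?_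
    rw [Finset.mem_Ico] at hy
    exact h.1.idxOf_lt hy.1 (by omega)
  rw [this, hc]
  omega

theorem IsAscentSequence.of_append {n a : ℕ} {α : List ℕ}
    (h : IsAscentSequence (n + 1) (α ++ [a])) :
    IsAscentSequence n α ∧ (n = 0 → a = 0) ∧ (1 ≤ n → a ≤ 1 + asc α) := by
  obtain ⟨hl, h⟩ := h
  have hl : α.length = n := by simpa using hl
  refine ⟨⟨hl, ?_⟩, ?_⟩
  · rintro ⟨i, hi⟩
    have := h ⟨i, by simp; omega⟩
    simpa [List.getElem_append_left hi, List.take_append_of_le_length hi.le] using this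
  · have := h ⟨n, by simp; omega⟩
    simpa [← hl] using this

theorem exists_isFishburn_g_eq {n : ℕ} {α : List ℕ} (h : IsAscentSequence n α) :
    ∃ π, IsFishburn n π ∧ g π = α := by
  induction n generalizing α with
  | zero =>
    obtain rfl := List.length_eq_zero_iff.1 h.1
    exact ⟨[], isFishburn_nil_iff.2 rfl, rfl⟩
  | succ n ih =>
    obtain ⟨β, a, rfl⟩ : ∃ β a, α = β ++ [a] :=
      ⟨_, _, (List.dropLast_append_getLast (List.ne_nil_of_length_eq_add_one h.1)).symm⟩
    obtain ⟨hβ, h0, h1⟩ := h.of_append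
    obtain ⟨σ, hσ, rfl⟩ := ih hβ
    have hlt : a < siteLabel σ (n + 1) := by
      cases n with
      | zero => simp [h0 rfl, siteLabel_succ, hσ.isActiveSite_zero]
      | succ n =>
        rw [hσ.siteLabel_length]
        have := h1 (by omega)
        omega
    obtain ⟨s, hs, rfl⟩ := exists_isActiveSite_of_lt_siteLabel hlt
    have hsn := hs.1
    have hF := hs.2
    rw [hσ.1.length_eq, insertIdx_eq_take_append_cons_drop hsn] at hF
    refine ⟨_, hF, ?_⟩
    rw [g_insert (by rw [List.take_append_drop]; exact hσ.1), List.take_append_drop,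
      List.length_take, Nat.min_eq_left hsn]

theorem contains_201_iff {α : List ℕ} : Contains α [2, 0, 1] ↔
    ∃ i j k, ∃ (hij : i < j) (hjk : j < k) (hk : k < α.length), α[j] < α[k] ∧ α[k] < α[i] := by
  constructor
  · rintro ⟨f, hf, h⟩
    refine ⟨f 0, f 1, f 2, hf (by decide), hf (by decide), (f 2).2, ?_, ?_⟩
    · exact (h 1 2).2 (by decide)
    · exact (h 2 0).2 (by decide)
  · rintro ⟨i, j, k, hij, hjk, hk, h1, h2⟩
    refine ⟨![⟨i, by omega⟩, ⟨j, by omega⟩, ⟨k, hk⟩], ?_, ?_⟩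
    · rw [Fin.strictMono_iff_lt_succ]
      intro x
      fin_cases x
      · exact hij
      · exact hjk
    · intro x y
      fin_cases x <;> fin_cases y <;> simp <;> omega

theorem contains_3412_iff {n : ℕ} {π : List ℕ} (h : IsPermutation n π) :
    Contains π [3, 4, 1, 2] ↔ ∃ a b c d, 1 ≤ a ∧ a < b ∧ b < c ∧ c < d ∧ d ≤ n ∧
      π.idxOf c < π.idxOf d ∧ π.idxOf d < π.idxOf a ∧ π.idxOf a < π.idxOf b := by
  constructor
  · rintro ⟨f, hf, hc⟩
    have hidx : ∀ x, π.idxOf (π.get (f x)) = f x := fun x => h.nodup.idxOf_getElem _ _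
    refine ⟨π.get (f 2), π.get (f 3), π.get (f 0), π.get (f 1),
      (h.mem_iff.1 (List.get_mem _ _)).1, (hc 2 3).2 (by decide), (hc 3 0).2 (by decide),
      (hc 0 1).2 (by decide), (h.mem_iff.1 (List.get_mem _ _)).2, ?_, ?_, ?_⟩
    · rw [hidx, hidx]
      exact hf (by decide)
    · rw [hidx, hidx]
      exact hf (by decide)
    · rw [hidx, hidx]
      exact hf (by decide)
  · rintro ⟨a, b, c, d, ha, hab, hbc, hcd, hd, h1, h2, h3⟩
    have hlt : ∀ x, 1 ≤ x → x ≤ n → π.idxOf x < π.length := fun x hx hx' =>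
      List.idxOf_lt_length_of_mem (h.mem_iff.2 ⟨hx, hx'⟩)
    refine ⟨![⟨π.idxOf c, hlt c (by omega) (by omega)⟩, ⟨π.idxOf d, hlt d (by omega) (by omega)⟩,
      ⟨π.idxOf a, hlt a (by omega) (by omega)⟩, ⟨π.idxOf b, hlt b (by omega) (by omega)⟩], ?_, ?_⟩
    · rw [Fin.strictMono_iff_lt_succ]
      intro x
      fin_cases x
      · exact h1
      · exact h2
      · exact h3
    · intro x y
      fin_cases x <;> fin_cases y <;> simp <;> omega

theorem IsFishburn.avoids_iff {n : ℕ} {π : List ℕ} (h : IsFishburn n π) :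
    Avoids π [3, 4, 1, 2] ↔ Avoids (g π) [2, 0, 1] := by
  have hp := h.isFishburnPosition
  unfold Avoids
  rw [not_iff_not, contains_3412_iff h.1, contains_201_iff, h.g_eq_map]
  simp only [List.getElem_map, List.getElem_range', one_mul, List.length_map, List.length_range']
  constructor
  · intro hpat
    obtain ⟨i, j, k, hi, hij, hjk, hk, h1, h2⟩ := hp.exists_posLabel_of_pattern hpat
    obtain ⟨i, rfl⟩ := Nat.exists_eq_add_of_le hi
    obtain ⟨j, rfl⟩ := Nat.exists_eq_add_of_le (show 1 ≤ j by omega)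
    obtain ⟨k, rfl⟩ := Nat.exists_eq_add_of_le (show 1 ≤ k by omega)
    exact ⟨i, j, k, by omega, by omega, by omega, h1, h2⟩
  · rintro ⟨i, j, k, hij, hjk, hk, h1, h2⟩
    exact hp.exists_pattern_of_posLabel (by omega) (by omega) (by omega) h1 h2

theorem bijOn_g (n : ℕ) : Set.BijOn g (F n [3, 4, 1, 2]) (A n [2, 0, 1]) := by
  refine ⟨fun π h => ⟨h.1.isAscentSequence_g, h.1.avoids_iff.1 h.2⟩,
    fun π h π' h' hg => h.1.g_injective h'.1 hg, fun α h => ?_⟩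
  obtain ⟨π, hπ, rfl⟩ := exists_isFishburn_g_eq h.1
  exact ⟨π, ⟨hπ, hπ.avoids_iff.2 h.2⟩, rfl⟩

end Fishburn

theorem mainTheorem1 :
    (∀ (n : ℕ) (π : List ℕ), Fishburn.IsFishburn n π →
      (Fishburn.Avoids π [3, 4, 1, 2] ↔ Fishburn.Avoids (Fishburn.g π) [2, 0, 1])) ∧
    (∀ n : ℕ, Set.BijOn Fishburn.g (Fishburn.F n [3, 4, 1, 2]) (Fishburn.A n [2, 0, 1])) ∧
    (∀ n : ℕ, (Fishburn.F n [3, 4, 1, 2]).ncard = (Fishburn.A n [2, 0, 1]).ncard) := by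
  refine ⟨fun n π h => h.avoids_iff, Fishburn.bijOn_g, fun n => ?_⟩
  rw [← (Fishburn.bijOn_g n).image_eq, (Fishburn.bijOn_g n).injOn.ncard_image]
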